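/- Let $n\ge 2$ and let $(C,W)$ be a weighted spherical code on the unit sphere $\mathbb{S}^{n-1}\subset\mathbb{R}^n$, i.e. $C=(x_1,\dots,x_N)$ is an $N$-tuple of distinct points of $\mathbb{S}^{n-1}$ and $W=(w_1,\dots,w_N)$ are weights with $w_i>0$ and $w_1+\cdots+w_N=1$. Let $P_\ell^{(n)}$, $\ell=0,1,2,\dots$, be the Gegenbauer polynomials: $\deg P_\ell^{(n)}=\ell$, $P_\ell^{(n)}(1)=1$, and they are pairwise orthogonal on $[-1,1]$ with respect to the weight $(1-t^2)^{(n-3)/2}\,dt$. For an integer $\tau\ge 0$, $(C,W)$ is called a weighted spherical $\tau$-design if $$M_\ell(C,W):=\sum_{i,j=1}^N w_iw_jP_\ell^{(n)}(x_i\cdot x_j)=0\quad\text{for all }1\le\ell\le\tau .$$ Then $(C,W)$ is a weighted spherical $\tau$-design if and only if $$\int_{\mathbb{S}^{n-1}}p(y)\,d\sigma_n(y)=\sum_{i=1}^N w_i\,p(x_i)$$ for all real polynomials $p$ in $n$ variables of total degree at most $\tau$, where $\sigma_n$ is the Lebesgue surface measure on $\mathbb{S}^{n-1}$ normalized so that $\sigma_n(\mathbb{S}^{n-1})=1$.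 -/

import Mathlib

open MeasureTheory

noncomputable section

namespace SphericalDesign

/-- The Gegenbauer polynomials `P_ℓ^{(n)}`, given by their three-term recurrence
`(ℓ + n - 2) P_{ℓ+1} = (2ℓ + n - 2) t P_ℓ - ℓ P_{ℓ-1}` for `ℓ ≥ 1`, with `P_0 = 1`, `P_1 = t`.
For `n ≥ 2` they are the polynomials of degree `ℓ` with `P_ℓ(1) = 1` that are orthogonal with
respect to the weight `(1 - t²)^{(n-3)/2}` on `[-1, 1]`; this is proved below in
`gegenbauer_natDegree`, `gegenbauer_eval_one` and `gegenbauer_orthogonal`. -/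
def gegenbauer (n : ℕ) : ℕ → Polynomial ℝ
  | 0 => 1
  | 1 => Polynomial.X
  | ℓ + 2 =>
      Polynomial.C ((2 * ℓ + n : ℝ) / (ℓ + n - 1)) * Polynomial.X * gegenbauer n (ℓ + 1)
        - Polynomial.C ((ℓ + 1 : ℝ) / (ℓ + n - 1)) * gegenbauer n ℓ

/-- A weighted spherical code on the unit sphere of `ℝⁿ`: an `N`-tuple of distinct points of the
sphere with positive weights of total mass one. -/
structure WeightedCode (n N : ℕ) where
  pt : Fin N → EuclideanSpace ℝ (Fin n)
  norm_pt : ∀ i, ‖pt i‖ = 1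
  pt_injective : Function.Injective pt
  weight : Fin N → ℝ
  weight_pos : ∀ i, 0 < weight i
  weight_sum : ∑ i, weight i = 1

/-- The weighted moment `M_ℓ(C, W) = ∑ w_i w_j P_ℓ^{(n)}(x_i · x_j)`, over all ordered pairs
`(i, j)`, the diagonal included. -/
def WeightedCode.moment {n N : ℕ} (C : WeightedCode n N) (ℓ : ℕ) : ℝ :=
  ∑ i, ∑ j, C.weight i * C.weight j *
    (gegenbauer n ℓ).eval (inner ℝ (C.pt i) (C.pt j))

/-- A weighted spherical `τ`-design: the moments of orders `1, …, τ` vanish. -/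
def WeightedCode.IsDesign {n N : ℕ} (C : WeightedCode n N) (τ : ℕ) : Prop :=
  ∀ ℓ : ℕ, 1 ≤ ℓ → ℓ ≤ τ → C.moment ℓ = 0

/-- The Lebesgue surface measure on the unit sphere of `ℝⁿ`, normalized to total mass one. -/
def sphereProb (n : ℕ) : Measure (Metric.sphere (0 : EuclideanSpace ℝ (Fin n)) 1) :=
  ((volume : Measure (EuclideanSpace ℝ (Fin n))).toSphere Set.univ)⁻¹ •
    (volume : Measure (EuclideanSpace ℝ (Fin n))).toSphere

lemma sphereProb_univ {n : ℕ} (hn : 1 ≤ n) : sphereProb n Set.univ = 1 := by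
  have : Nonempty (Fin n) := ⟨⟨0, hn⟩⟩
  have h0 : (volume : Measure (EuclideanSpace ℝ (Fin n))).toSphere Set.univ ≠ 0 := by
    rw [Measure.toSphere_apply_univ]
    refine mul_ne_zero (by simp; omega) (Metric.measure_ball_pos _ _ one_pos).ne'
  have h1 : (volume : Measure (EuclideanSpace ℝ (Fin n))).toSphere Set.univ ≠ ⊤ :=
    measure_ne_top _ _
  simp only [sphereProb, Measure.smul_apply, smul_eq_mul]
  exact ENNReal.inv_mul_cancel h0 h1

lemma gegenbauer_eval_one {n : ℕ} (hn : 2 ≤ n) (ℓ : ℕ) : (gegenbauer n ℓ).eval 1 = 1 := by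
  have hn' : (2 : ℝ) ≤ n := by exact_mod_cast hn
  induction ℓ using Nat.twoStepInduction with
  | zero => simp [gegenbauer]
  | one => simp [gegenbauer]
  | more ℓ h0 h1 =>
    have : (ℓ : ℝ) + n - 1 ≠ 0 := by
      have : (0 : ℝ) ≤ ℓ := Nat.cast_nonneg _
      linarith
    simp [gegenbauer, h0, h1]
    field_simp
    ring

lemma gegenbauer_natDegree_leadingCoeff {n : ℕ} (hn : 2 ≤ n) (ℓ : ℕ) :
    (gegenbauer n ℓ).natDegree ≤ ℓ ∧ (gegenbauer n ℓ).coeff ℓ ≠ 0 := by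
  have hn' : (2 : ℝ) ≤ n := by exact_mod_cast hn
  induction ℓ using Nat.twoStepInduction with
  | zero => simp [gegenbauer]
  | one => simp [gegenbauer]
  | more ℓ h0 h1 =>
    have hℓ : (0 : ℝ) ≤ ℓ := Nat.cast_nonneg _
    constructor
    · rw [gegenbauer]
      refine (Polynomial.natDegree_sub_le _ _).trans (max_le ?_ ?_)
      · refine Polynomial.natDegree_mul_le.trans ?_
        have : (Polynomial.C ((2 * ℓ + n : ℝ) / (ℓ + n - 1)) * Polynomial.X).natDegree ≤ 1 :=
          (Polynomial.natDegree_C_mul_le _ _).trans Polynomial.natDegree_X_le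
        omega
      · exact (Polynomial.natDegree_C_mul_le _ _).trans (by omega)
    · rw [gegenbauer, mul_assoc, Polynomial.coeff_sub, Polynomial.coeff_C_mul,
        Polynomial.coeff_X_mul, Polynomial.coeff_C_mul,
        Polynomial.coeff_eq_zero_of_natDegree_lt (p := gegenbauer n ℓ) (by omega), mul_zero,
        sub_zero]
      refine mul_ne_zero (div_ne_zero ?_ ?_) h1.2 <;> linarith

lemma gegenbauer_natDegree {n : ℕ} (hn : 2 ≤ n) (ℓ : ℕ) : (gegenbauer n ℓ).natDegree = ℓ :=
  le_antisymm (gegenbauer_natDegree_leadingCoeff hn ℓ).1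
    (Polynomial.le_natDegree_of_ne_zero (gegenbauer_natDegree_leadingCoeff hn ℓ).2)

lemma gegenbauer_recurrence {n : ℕ} (hn : 2 ≤ n) (ℓ : ℕ) :
    ((ℓ : Polynomial ℝ) + (n : Polynomial ℝ) - 1) * gegenbauer n (ℓ + 2) =
      (2 * (ℓ : Polynomial ℝ) + (n : Polynomial ℝ)) * Polynomial.X * gegenbauer n (ℓ + 1)
        - ((ℓ : Polynomial ℝ) + 1) * gegenbauer n ℓ := by
  have hn' : (2 : ℝ) ≤ n := by exact_mod_cast hn
  have hℓ : (0 : ℝ) ≤ ℓ := Nat.cast_nonneg _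
  have hd : (ℓ : ℝ) + n - 1 ≠ 0 := by linarith
  have e : ((ℓ : Polynomial ℝ) + n - 1) = Polynomial.C ((ℓ : ℝ) + n - 1) := by simp
  have h1 : Polynomial.C ((ℓ : ℝ) + n - 1) * Polynomial.C ((2 * ℓ + n : ℝ) / (ℓ + n - 1)) =
      2 * (ℓ : Polynomial ℝ) + (n : Polynomial ℝ) := by
    rw [← Polynomial.C_mul, mul_div_cancel₀ _ hd]; simp [Polynomial.C_ofNat]
  have h2 : Polynomial.C ((ℓ : ℝ) + n - 1) * Polynomial.C ((ℓ + 1 : ℝ) / (ℓ + n - 1)) =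
      (ℓ : Polynomial ℝ) + 1 := by
    rw [← Polynomial.C_mul, mul_div_cancel₀ _ hd]; simp
  rw [e, gegenbauer]
  linear_combination (Polynomial.X * gegenbauer n (ℓ + 1)) * h1 - gegenbauer n ℓ * h2

lemma gegenbauer_derivative_aux {n : ℕ} (hn : 2 ≤ n) (ℓ : ℕ) :
    (1 - Polynomial.X ^ 2) * (gegenbauer n (ℓ + 1)).derivative =
        ((ℓ : Polynomial ℝ) + 1) * (gegenbauer n ℓ - Polynomial.X * gegenbauer n (ℓ + 1)) ∧
      (1 - Polynomial.X ^ 2) * (gegenbauer n ℓ).derivative =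
        ((ℓ : Polynomial ℝ) + (n : Polynomial ℝ) - 2) *
          (Polynomial.X * gegenbauer n ℓ - gegenbauer n (ℓ + 1)) := by
  have hn' : (2 : ℝ) ≤ n := by exact_mod_cast hn
  induction ℓ with
  | zero => exact ⟨by simp [gegenbauer]; ring, by simp [gegenbauer]⟩
  | succ ℓ ih =>
    obtain ⟨ih, key⟩ := ih
    have hd : ((ℓ : Polynomial ℝ) + n - 1) ≠ 0 := by
      have e : ((ℓ : Polynomial ℝ) + n - 1) = Polynomial.C ((ℓ : ℝ) + n - 1) := by simp
      have hℓ : (0 : ℝ) ≤ ℓ := Nat.cast_nonneg _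
      rw [e, Polynomial.C_ne_zero]; linarith
    have r := gegenbauer_recurrence hn ℓ
    have rd := congrArg Polynomial.derivative r
    simp at rd
    push_cast
    refine ⟨mul_left_cancel₀ hd ?_, by linear_combination ih + r⟩
    linear_combination (1 - Polynomial.X ^ 2) * rd +
      (2 * (ℓ : Polynomial ℝ) + n) * Polynomial.X * ih - ((ℓ : Polynomial ℝ) + 1) * key
      + ((ℓ : Polynomial ℝ) + 2) * Polynomial.X * r

lemma gegenbauer_ode {n : ℕ} (hn : 2 ≤ n) (ℓ : ℕ) :
    (1 - Polynomial.X ^ 2) * (gegenbauer n ℓ).derivative.derivative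
      - ((n : Polynomial ℝ) - 1) * Polynomial.X * (gegenbauer n ℓ).derivative
      + (ℓ : Polynomial ℝ) * ((ℓ : Polynomial ℝ) + (n : Polynomial ℝ) - 2) * gegenbauer n ℓ
      = 0 := by
  rcases ℓ with _ | ℓ
  · simp [gegenbauer]
  · obtain ⟨D, key⟩ := gegenbauer_derivative_aux hn ℓ
    have dD := congrArg Polynomial.derivative D
    simp at dD
    have hX : (1 - Polynomial.X ^ 2 : Polynomial ℝ) ≠ 0 := by
      intro h
      have := congrArg (Polynomial.eval 0) h
      simp at this
    apply mul_left_cancel₀ hX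
    push_cast
    linear_combination (1 - Polynomial.X ^ 2) * dD + ((ℓ : Polynomial ℝ) + 1) * key
      + (2 - (ℓ : Polynomial ℝ) - n) * Polynomial.X * D

/-- The Gegenbauer weight is integrable for `n ≥ 2`. -/
lemma gegenbauerWeight_integrable {n : ℕ} (hn : 2 ≤ n) :
    IntervalIntegrable (fun t : ℝ => (1 - t ^ 2) ^ (((n : ℝ) - 3) / 2)) volume (-1) 1 := by
  have hn' : (2 : ℝ) ≤ n := by exact_mod_cast hn
  have h1 : IntervalIntegrable (fun t : ℝ => 1 / √(1 - t ^ 2)) volume (-1) 1 := by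
    refine intervalIntegral.intervalIntegrable_deriv_of_nonneg (g := Real.arcsin)
      Real.continuous_arcsin.continuousOn ?_ ?_
    · intro x hx
      norm_num at hx
      exact Real.hasDerivAt_arcsin (by linarith [hx.1]) (by linarith [hx.2])
    · intro x _
      positivity
  refine h1.mono_fun (Measurable.aestronglyMeasurable (by fun_prop)) ?_
  filter_upwards [ae_restrict_mem measurableSet_uIoc,
    compl_mem_ae_iff.2 (measure_singleton (μ := volume.restrict (Set.uIoc (-1 : ℝ) 1)) 1)]
    with t ht ht1
  rw [Set.uIoc_of_le (by norm_num)] at ht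
  have h1' : t < 1 := lt_of_le_of_ne ht.2 ht1
  have hpos : 0 < 1 - t ^ 2 := by nlinarith [ht.1]
  rw [Real.norm_of_nonneg (by positivity), Real.norm_of_nonneg (by positivity),
    Real.sqrt_eq_rpow, one_div, ← Real.rpow_neg hpos.le]
  exact Real.rpow_le_rpow_of_exponent_ge hpos (by nlinarith) (by linarith)

/-- Orthogonality of the Gegenbauer polynomials. -/
lemma gegenbauer_orthogonal {n : ℕ} (hn : 2 ≤ n) {j k : ℕ} (hjk : j ≠ k) :
    ∫ t in (-1 : ℝ)..1, (gegenbauer n j).eval t * (gegenbauer n k).eval t *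
      (1 - t ^ 2) ^ (((n : ℝ) - 3) / 2) = 0 := by
  have hn' : (2 : ℝ) ≤ n := by exact_mod_cast hn
  set P := gegenbauer n j with hP
  set Q := gegenbauer n k with hQ
  set p : Polynomial ℝ := P.derivative * Q - Q.derivative * P with hp
  set lam : ℝ := k * (k + n - 2) - j * (j + n - 2) with hlam
  have hlam0 : lam ≠ 0 := by
    have e : lam = ((k : ℝ) - j) * (k + j + (n - 2)) := by rw [hlam]; ring
    have hj : (0 : ℝ) ≤ j := Nat.cast_nonneg _
    have hk : (0 : ℝ) ≤ k := Nat.cast_nonneg _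
    have hs : (1 : ℝ) ≤ k + j := by
      have : 1 ≤ k + j := by omega
      exact_mod_cast this
    rw [e]
    refine mul_ne_zero (sub_ne_zero.2 ?_) (by linarith)
    exact_mod_cast hjk.symm
  have hF : ∫ t in (-1 : ℝ)..1, lam * (P.eval t * Q.eval t *
      (1 - t ^ 2) ^ (((n : ℝ) - 3) / 2)) = 0 := by
    rw [intervalIntegral.integral_eq_sub_of_hasDerivAt_of_le (by norm_num)
      (f := fun t => (1 - t ^ 2) ^ (((n : ℝ) - 1) / 2) * p.eval t)]
    · have : ((n : ℝ) - 1) / 2 ≠ 0 := by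
        have : (0 : ℝ) < ((n : ℝ) - 1) / 2 := by linarith
        exact this.ne'
      simp [Real.zero_rpow this]
    · refine ContinuousOn.mul ?_ p.continuous.continuousOn
      exact ContinuousOn.rpow_const (by fun_prop) fun t _ => Or.inr (by linarith)
    · intro t ht
      have hpos : 0 < 1 - t ^ 2 := by nlinarith [ht.1, ht.2]
      have hb : HasDerivAt (fun t : ℝ => 1 - t ^ 2) (-(2 * t)) t := by
        simpa using ((hasDerivAt_id t).pow 2).const_sub 1
      have hd := (hb.rpow_const (p := ((n : ℝ) - 1) / 2) (Or.inl hpos.ne')).mul (p.hasDerivAt t)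
      refine hd.congr_deriv ?_
      have e1 : ((n : ℝ) - 1) / 2 - 1 = ((n : ℝ) - 3) / 2 := by ring
      have e2 : (1 - t ^ 2) ^ (((n : ℝ) - 1) / 2) =
          (1 - t ^ 2) ^ (((n : ℝ) - 3) / 2) * (1 - t ^ 2) := by
        rw [← Real.rpow_add_one hpos.ne']; congr 1; ring
      have oP := congrArg (Polynomial.eval t) (gegenbauer_ode hn j)
      have oQ := congrArg (Polynomial.eval t) (gegenbauer_ode hn k)
      rw [← hP] at oP
      rw [← hQ] at oQ
      simp at oP oQ
      rw [e1, e2, hp, hlam]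
      simp
      linear_combination (1 - t ^ 2) ^ (((n : ℝ) - 3) / 2) *
        (Polynomial.eval t Q * oP - Polynomial.eval t P * oQ)
    · refine ((gegenbauerWeight_integrable hn).continuousOn_mul
        (P.continuous.mul Q.continuous).continuousOn).const_mul lam
  rw [intervalIntegral.integral_const_mul] at hF
  exact (mul_eq_zero.1 hF).resolve_left hlam0

end SphericalDesign

end

/-! Both directions use the zonal polynomial `zonal x ℓ`, which is homogeneous of degree `ℓ`,
harmonic (`laplace_zonal`) and equal to `P_ℓ(x · y)` for unit `x`, `y` (`eval_zonal`). For `ℓ ≥ 1` a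
homogeneous harmonic polynomial has mean zero on the sphere (`integral_sphere_harmonic`).

If the cubature formula is exact, applying it to `zonal (x_i) ℓ` gives `∑ j, w_j P_ℓ(x_i · x_j) = 0`
for each `i`, so every moment vanishes.

Conversely, the kernel `P_ℓ(x · y)` is positive semidefinite (`gegenbauer_posSemidef`): up to a
positive factor it is the Gram kernel of the zonal polynomials for the Fischer product. A null
vector of a semidefinite form is orthogonal to everything, so `M_ℓ = 0` forces `∑ i, w_i P_ℓ(x_i ·
y) = 0` for every unit `y`. The formula is then exact for `y ↦ P_ℓ(x · y)`, `ℓ ≤ τ`, hence for `(x ·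
y)^d`, `d ≤ τ`, and by polarization (`eq_zero_of_linForm_pow`) for every monomial of degree at most
`τ`. -/

noncomputable section

namespace SphericalDesign

open MvPolynomial

/-! ### Zonal harmonic polynomials. -/

section Algebra

variable {n : ℕ}

/-- The linear form `Y ↦ x · Y`. -/
def linForm (x : Fin n → ℝ) : MvPolynomial (Fin n) ℝ := ∑ i, C (x i) * X i

/-- The quadratic form `|Y|²`. -/
def normSqForm (n : ℕ) : MvPolynomial (Fin n) ℝ := ∑ i, X i * X i

/-- The derivation in the direction `x`. -/
def dirDeriv (x : Fin n → ℝ) : Derivation ℝ (MvPolynomial (Fin n) ℝ) (MvPolynomial (Fin n) ℝ) :=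
  ∑ i, x i • pderiv i

/-- The Laplace operator on polynomials. -/
def laplace (p : MvPolynomial (Fin n) ℝ) : MvPolynomial (Fin n) ℝ := ∑ i, pderiv i (pderiv i p)

lemma dirDeriv_apply (x : Fin n → ℝ) (p : MvPolynomial (Fin n) ℝ) :
    dirDeriv x p = ∑ i, C (x i) * pderiv i p := by
  have h : ((∑ i, x i • pderiv i :
      Derivation ℝ (MvPolynomial (Fin n) ℝ) (MvPolynomial (Fin n) ℝ)) :
        MvPolynomial (Fin n) ℝ → MvPolynomial (Fin n) ℝ) = ∑ i, ⇑(x i • pderiv i) :=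
    map_sum Derivation.coeFnAddMonoidHom _ _
  simp [dirDeriv, h, C_mul']

lemma pderiv_linForm (x : Fin n → ℝ) (i : Fin n) : pderiv i (linForm x) = C (x i) := by
  simp [linForm, pderiv_X, Pi.single_apply]

lemma pderiv_normSqForm (i : Fin n) : pderiv i (normSqForm n) = 2 * X i := by
  simp [normSqForm, pderiv_X, Pi.single_apply, Finset.sum_add_distrib]
  ring

lemma dirDeriv_linForm (x : Fin n → ℝ) : dirDeriv x (linForm x) = C (∑ i, x i ^ 2) := by
  simp [dirDeriv_apply, pderiv_linForm, pow_two]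

lemma dirDeriv_normSqForm (x : Fin n → ℝ) : dirDeriv x (normSqForm n) = 2 * linForm x := by
  simp only [dirDeriv_apply, pderiv_normSqForm, linForm, Finset.mul_sum]
  exact Finset.sum_congr rfl fun i _ => by ring

lemma dirDeriv_C (x : Fin n → ℝ) (a : ℝ) : dirDeriv x (C a) = 0 := by
  simp

lemma pderiv_comm (i j : Fin n) (p : MvPolynomial (Fin n) ℝ) :
    pderiv i (pderiv j p) = pderiv j (pderiv i p) := by
  ext m
  rcases eq_or_ne i j with rfl | hij
  · rfl
  simp only [coeff_pderiv, Finsupp.add_apply, Finsupp.single_eq_of_ne hij,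
    Finsupp.single_eq_of_ne hij.symm]
  rw [add_right_comm]
  push_cast
  ring

lemma laplace_sub (p q : MvPolynomial (Fin n) ℝ) : laplace (p - q) = laplace p - laplace q := by
  simp [laplace, Finset.sum_sub_distrib]

lemma laplace_C_mul (a : ℝ) (p : MvPolynomial (Fin n) ℝ) :
    laplace (C a * p) = C a * laplace p := by
  simp only [laplace, pderiv_C_mul, Finset.mul_sum]

lemma laplace_dirDeriv (x : Fin n → ℝ) (p : MvPolynomial (Fin n) ℝ) :
    laplace (dirDeriv x p) = dirDeriv x (laplace p) := by
  simp only [laplace, dirDeriv_apply, map_sum, pderiv_C_mul]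
  refine Finset.sum_congr rfl fun i _ => Finset.sum_congr rfl fun j _ => ?_
  rw [pderiv_comm i j p, pderiv_comm i j]

lemma laplace_linForm_mul (x : Fin n → ℝ) (p : MvPolynomial (Fin n) ℝ) :
    laplace (linForm x * p) = 2 * dirDeriv x p + linForm x * laplace p := by
  simp only [laplace, dirDeriv_apply, Finset.mul_sum, ← Finset.sum_add_distrib]
  refine Finset.sum_congr rfl fun i _ => ?_
  simp only [pderiv_mul, map_add, pderiv_linForm, pderiv_C]
  ring

/-- The cross terms sum to `4 ∑ X_i ∂_i p`, which is `4dp` by Euler's identity. -/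
lemma laplace_normSqForm_mul {d : ℕ} {p : MvPolynomial (Fin n) ℝ} (hp : p.IsHomogeneous d) :
    laplace (normSqForm n * p) = C (2 * n + 4 * d : ℝ) * p + normSqForm n * laplace p := by
  have h := hp.sum_X_mul_pderiv
  -- Writing the scalar term as a sum over `i` through Euler's identity lets the claim be checked
  -- one coordinate at a time.
  have e : C (2 * n + 4 * d : ℝ) * p = ∑ i : Fin n, (2 * p + 4 * (X i * pderiv i p)) := by
    rw [Finset.sum_add_distrib, ← Finset.mul_sum, ← Finset.mul_sum, h]
    simp
    simp only [map_ofNat]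
    ring
  rw [e]
  simp only [laplace, Finset.mul_sum, ← Finset.sum_add_distrib]
  refine Finset.sum_congr rfl fun i _ => ?_
  have h2 : pderiv i (2 : MvPolynomial (Fin n) ℝ) = 0 := by
    rw [← map_ofNat (C : ℝ →+* MvPolynomial (Fin n) ℝ) 2, pderiv_C]
  simp only [pderiv_mul, map_add, pderiv_normSqForm, pderiv_X_self, h2]
  ring

lemma isHomogeneous_linForm (x : Fin n → ℝ) : (linForm x).IsHomogeneous 1 := by
  refine IsHomogeneous.sum _ _ _ fun i _ => ?_
  simpa using (isHomogeneous_C (Fin n) (x i)).mul (isHomogeneous_X ℝ i)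

lemma isHomogeneous_normSqForm : (normSqForm n).IsHomogeneous 2 :=
  IsHomogeneous.sum _ _ _ fun i _ => (isHomogeneous_X ℝ i).mul (isHomogeneous_X ℝ i)

lemma isHomogeneous_dirDeriv (x : Fin n → ℝ) {d : ℕ} {p : MvPolynomial (Fin n) ℝ}
    (hp : p.IsHomogeneous (d + 1)) : (dirDeriv x p).IsHomogeneous d := by
  rw [dirDeriv_apply]
  refine IsHomogeneous.sum _ _ _ fun i _ => ?_
  simpa using (isHomogeneous_C (Fin n) (x i)).mul hp.pderiv

/-- The zonal harmonic `|x|^ℓ |Y|^ℓ P_ℓ(x · Y / (|x| |Y|))`, as a polynomial in `Y`. -/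
def zonal (x : Fin n → ℝ) : ℕ → MvPolynomial (Fin n) ℝ
  | 0 => 1
  | 1 => linForm x
  | ℓ + 2 =>
      C ((2 * ℓ + n : ℝ) / (ℓ + n - 1)) * (linForm x * zonal x (ℓ + 1))
        - C ((ℓ + 1 : ℝ) / (ℓ + n - 1) * ∑ i, x i ^ 2) * (normSqForm n * zonal x ℓ)

lemma isHomogeneous_zonal (x : Fin n → ℝ) (ℓ : ℕ) : (zonal x ℓ).IsHomogeneous ℓ := by
  induction ℓ using Nat.twoStepInduction with
  | zero => exact isHomogeneous_one _ _
  | one => exact isHomogeneous_linForm x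
  | more ℓ h0 h1 =>
    rw [zonal]
    refine IsHomogeneous.sub ?_ ?_
    · have := (isHomogeneous_C (Fin n) ((2 * ℓ + n : ℝ) / (ℓ + n - 1))).mul
        ((isHomogeneous_linForm x).mul h1)
      rwa [show 0 + (1 + (ℓ + 1)) = ℓ + 2 by omega] at this
    · have := (isHomogeneous_C (Fin n) ((ℓ + 1 : ℝ) / (ℓ + n - 1) * ∑ i, x i ^ 2)).mul
        (isHomogeneous_normSqForm.mul h0)
      rwa [show 0 + (2 + ℓ) = ℓ + 2 by omega] at this

lemma eval_linForm (x y : Fin n → ℝ) : eval y (linForm x) = ∑ i, x i * y i := by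
  simp [linForm]

lemma eval_normSqForm (y : Fin n → ℝ) : eval y (normSqForm n) = ∑ i, y i ^ 2 := by
  simp [normSqForm, pow_two]

/-- The factors `|x|²` and `|Y|²` homogenise the Gegenbauer recurrence; both equal 1 here. -/
lemma eval_zonal {x y : Fin n → ℝ} (hx : ∑ i, x i ^ 2 = 1) (hy : ∑ i, y i ^ 2 = 1) (ℓ : ℕ) :
    eval y (zonal x ℓ) = (gegenbauer n ℓ).eval (∑ i, x i * y i) := by
  induction ℓ using Nat.twoStepInduction with
  | zero => simp [zonal, gegenbauer]
  | one => simp [zonal, gegenbauer, eval_linForm]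
  | more ℓ h0 h1 =>
    simp only [zonal, gegenbauer, map_sub, map_mul, eval_C, eval_linForm, eval_normSqForm, h0, h1,
      hx, hy, Polynomial.eval_sub, Polynomial.eval_mul, Polynomial.eval_C, Polynomial.eval_X]
    ring

lemma zonal_recurrence (hn : 2 ≤ n) (x : Fin n → ℝ) (ℓ : ℕ) :
    C (ℓ + n - 1 : ℝ) * zonal x (ℓ + 2) =
      C (2 * ℓ + n : ℝ) * (linForm x * zonal x (ℓ + 1))
        - C (ℓ + 1 : ℝ) * C (∑ i, x i ^ 2) * (normSqForm n * zonal x ℓ) := by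
  have hn' : (2 : ℝ) ≤ n := by exact_mod_cast hn
  have hℓ : (0 : ℝ) ≤ ℓ := Nat.cast_nonneg _
  have hd : (ℓ : ℝ) + n - 1 ≠ 0 := by linarith
  have h1 : (C (ℓ + n - 1 : ℝ) : MvPolynomial (Fin n) ℝ) * C ((2 * ℓ + n : ℝ) / (ℓ + n - 1)) =
      C (2 * ℓ + n : ℝ) := by rw [← C_mul, mul_div_cancel₀ _ hd]
  have h2 : (C (ℓ + n - 1 : ℝ) : MvPolynomial (Fin n) ℝ) * C ((ℓ + 1 : ℝ) / (ℓ + n - 1)) =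
      C (ℓ + 1 : ℝ) := by rw [← C_mul, mul_div_cancel₀ _ hd]
  rw [zonal, C_mul]
  linear_combination (linForm x * zonal x (ℓ + 1)) * h1
    - (C (∑ i, x i ^ 2) * (normSqForm n * zonal x ℓ)) * h2

/-- Differentiating the recurrence along the pole `x` and inserting the two previous cases
reproduces the recurrence one step lower. This first-order relation is what makes the zonal
polynomials harmonic. -/
lemma dirDeriv_zonal_succ (hn : 2 ≤ n) (x : Fin n → ℝ) (ℓ : ℕ) :
    dirDeriv x (zonal x (ℓ + 1)) = C (ℓ + 1 : ℝ) * C (∑ i, x i ^ 2) * zonal x ℓ := by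
  have hn' : (2 : ℝ) ≤ n := by exact_mod_cast hn
  have hne : ∀ ℓ : ℕ, (C (ℓ + n - 1 : ℝ) : MvPolynomial (Fin n) ℝ) ≠ 0 := fun ℓ => by
    have hℓ : (0 : ℝ) ≤ ℓ := Nat.cast_nonneg _
    rw [Ne, C_eq_zero]
    linarith
  have hder : ∀ ℓ : ℕ, C (ℓ + n - 1 : ℝ) * dirDeriv x (zonal x (ℓ + 2)) =
      C (2 * ℓ + n : ℝ) * (linForm x * dirDeriv x (zonal x (ℓ + 1)) +
        C (∑ i, x i ^ 2) * zonal x (ℓ + 1))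
        - C (ℓ + 1 : ℝ) * C (∑ i, x i ^ 2) * (normSqForm n * dirDeriv x (zonal x ℓ)
          + 2 * linForm x * zonal x ℓ) := fun ℓ => by
    have := congrArg (dirDeriv x) (zonal_recurrence hn x ℓ)
    simp only [Derivation.map_sub, Derivation.leibniz, dirDeriv_C, smul_eq_mul, dirDeriv_linForm,
      dirDeriv_normSqForm] at this
    linear_combination this
  induction ℓ using Nat.twoStepInduction with
  | zero => simp [zonal, dirDeriv_linForm]
  | one =>
    apply mul_left_cancel₀ (hne 0)
    have h := hder 0
    simp only [zonal, dirDeriv_linForm, Derivation.map_one_eq_zero] at h ⊢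
    rw [h]
    simp
    ring
  | more ℓ h0 h1 =>
    apply mul_left_cancel₀ (hne (ℓ + 1))
    rw [hder (ℓ + 1), h1, h0]
    have r := zonal_recurrence hn x ℓ
    generalize (C (∑ i, x i ^ 2) : MvPolynomial (Fin n) ℝ) = S at r ⊢
    simp only [C_add, C_sub, C_mul, C_1, map_natCast, map_ofNat, Nat.cast_add, Nat.cast_one]
      at r ⊢
    linear_combination (-(ℓ + 2 : MvPolynomial (Fin n) ℝ) * S) * r

/-- The Laplacians of the two terms of the recurrence are multiples of `|x|² zonal x ℓ` that cancel:
`(2ℓ + n) · 2(ℓ + 1) = (ℓ + 1)(2n + 4ℓ)`. -/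
lemma laplace_zonal (hn : 2 ≤ n) (x : Fin n → ℝ) (ℓ : ℕ) : laplace (zonal x ℓ) = 0 := by
  induction ℓ using Nat.twoStepInduction with
  | zero => simp [zonal, laplace]
  | one => simp [zonal, laplace, pderiv_linForm]
  | more ℓ h0 h1 =>
    rw [zonal, laplace_sub, laplace_C_mul, laplace_C_mul, laplace_linForm_mul, h1,
      laplace_normSqForm_mul (isHomogeneous_zonal x ℓ), h0, dirDeriv_zonal_succ hn]
    simp only [div_eq_mul_inv, C_mul, C_add, map_ofNat, mul_zero, add_zero]
    ring

end Algebra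

/-! ### The Fischer product and positive semidefiniteness of the kernels. -/

section Fischer

variable {n : ℕ}

/-- The Fischer inner product `⟨p, q⟩ = ∑ α! p_α q_α`. -/
def fischer (q : MvPolynomial (Fin n) ℝ) : MvPolynomial (Fin n) ℝ →ₗ[ℝ] ℝ :=
  (basisMonomials (Fin n) ℝ).constr ℝ fun α => (∏ i, (α i).factorial : ℝ) * coeff α q

lemma fischer_monomial (q : MvPolynomial (Fin n) ℝ) (α : Fin n →₀ ℕ) (a : ℝ) :
    fischer q (monomial α a) = a * ((∏ i, (α i).factorial : ℝ) * coeff α q) := by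
  have h : monomial α a = a • basisMonomials (Fin n) ℝ α := by
    simp [smul_monomial]
  rw [h, map_smul, fischer, Module.Basis.constr_basis, smul_eq_mul]

lemma fischer_self_nonneg (p : MvPolynomial (Fin n) ℝ) : 0 ≤ fischer p p := by
  have h : fischer p p = ∑ α ∈ p.support, (∏ i, (α i).factorial : ℝ) * coeff α p ^ 2 := by
    conv_lhs => rw [p.as_sum]
    rw [map_sum]
    refine Finset.sum_congr rfl fun α _ => ?_
    rw [← p.as_sum, fischer_monomial]
    ring
  rw [h]
  positivity

lemma fischer_add_left (q r p : MvPolynomial (Fin n) ℝ) :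
    fischer (q + r) p = fischer q p + fischer r p := by
  induction p using MvPolynomial.induction_on' with
  | monomial α a => simp [fischer_monomial]; ring
  | add p p' h h' => rw [map_add, map_add, map_add, h, h']; ring

lemma fischer_smul_left (c : ℝ) (q p : MvPolynomial (Fin n) ℝ) :
    fischer (c • q) p = c * fischer q p := by
  induction p using MvPolynomial.induction_on' with
  | monomial α a => simp [fischer_monomial]; ring
  | add p p' h h' => rw [map_add, map_add, h, h']; ring

lemma fischer_sum_left {ι : Type*} (s : Finset ι) (q : ι → MvPolynomial (Fin n) ℝ)
    (p : MvPolynomial (Fin n) ℝ) : fischer (∑ i ∈ s, q i) p = ∑ i ∈ s, fischer (q i) p := by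
  classical
  induction s using Finset.induction_on with
  | empty => simpa using fischer_smul_left 0 0 p
  | insert a s ha ih => rw [Finset.sum_insert ha, Finset.sum_insert ha, fischer_add_left, ih]

/-- Multiplication by `X i` is adjoint to `∂_i`: the factor `α_i + 1` appears both in `(α + e_i)!`
and in the coefficient of `∂_i q`. Hence `x · Y` is adjoint to `dirDeriv x`, and `|Y|²` to
`laplace`. -/
lemma fischer_X_mul (q p : MvPolynomial (Fin n) ℝ) (i : Fin n) :
    fischer q (X i * p) = fischer (pderiv i q) p := by
  induction p using MvPolynomial.induction_on' with
  | monomial α a =>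
    have h : X i * monomial α a = monomial (α + Finsupp.single i 1) a := by
      rw [X, monomial_mul, one_mul, add_comm]
    rw [h, fischer_monomial, fischer_monomial, coeff_pderiv]
    have hf : (∏ j, (((α + Finsupp.single i 1 : Fin n →₀ ℕ) j).factorial : ℝ)) =
        (α i + 1) * ∏ j, ((α j).factorial : ℝ) := by
      rw [← Finset.mul_prod_erase _ _ (Finset.mem_univ i),
        ← Finset.mul_prod_erase (a := i) _ (fun j => ((α j).factorial : ℝ)) (Finset.mem_univ i)]
      have : ∀ j ∈ Finset.univ.erase i,
          (((α + Finsupp.single i 1 : Fin n →₀ ℕ) j).factorial : ℝ) = (α j).factorial := by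
        intro j hj
        simp [Finsupp.single_eq_of_ne (Finset.ne_of_mem_erase hj)]
      rw [Finset.prod_congr rfl this]
      simp [Nat.factorial_succ]
      ring
    rw [hf]
    ring
  | add p p' h h' => rw [mul_add, map_add, map_add, h, h']

lemma fischer_C_mul (q p : MvPolynomial (Fin n) ℝ) (a : ℝ) :
    fischer q (C a * p) = a * fischer q p := by
  rw [C_mul', map_smul, smul_eq_mul]

lemma fischer_linForm_mul (q p : MvPolynomial (Fin n) ℝ) (x : Fin n → ℝ) :
    fischer q (linForm x * p) = fischer (dirDeriv x q) p := by
  rw [linForm, Finset.sum_mul, map_sum, dirDeriv_apply, fischer_sum_left]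
  refine Finset.sum_congr rfl fun i _ => ?_
  rw [mul_assoc, fischer_C_mul, fischer_X_mul, C_mul', fischer_smul_left]

lemma fischer_normSqForm_mul (q p : MvPolynomial (Fin n) ℝ) :
    fischer q (normSqForm n * p) = fischer (laplace q) p := by
  rw [normSqForm, Finset.sum_mul, map_sum, laplace, fischer_sum_left]
  refine Finset.sum_congr rfl fun i _ => ?_
  rw [mul_assoc, fischer_X_mul, fischer_X_mul]

/-- Euler's identity evaluated at `x`. -/
lemma eval_dirDeriv_self (x : Fin n → ℝ) {d : ℕ} {g : MvPolynomial (Fin n) ℝ}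
    (hg : g.IsHomogeneous d) : eval x (dirDeriv x g) = d * eval x g := by
  have h := congrArg (eval x) hg.sum_X_mul_pderiv
  simpa [dirDeriv_apply] using h

/-- Zonal harmonics are reproducing kernels, up to a positive factor, for the Fischer product. -/
lemma exists_fischer_zonal (hn : 2 ≤ n) (ℓ : ℕ) :
    ∃ c : ℝ, 0 < c ∧ ∀ (x : Fin n → ℝ) (g : MvPolynomial (Fin n) ℝ), g.IsHomogeneous ℓ →
      laplace g = 0 → fischer g (zonal x ℓ) = c * eval x g := by
  have hn' : (2 : ℝ) ≤ n := by exact_mod_cast hn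
  have hone : ∀ (x : Fin n → ℝ) (g : MvPolynomial (Fin n) ℝ), g.IsHomogeneous 0 →
      fischer g 1 = eval x g := by
    intro x g hg
    rw [← totalDegree_zero_iff_isHomogeneous, totalDegree_eq_zero_iff_eq_C] at hg
    have := fischer_monomial g 0 1
    rw [monomial_zero', C_1, one_mul] at this
    rw [this]
    conv_rhs => rw [hg]
    simp
  induction ℓ using Nat.twoStepInduction with
  | zero => exact ⟨1, one_pos, fun x g hg _ => by rw [zonal, hone x g hg, one_mul]⟩
  | one =>
    refine ⟨1, one_pos, fun x g hg _ => ?_⟩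
    rw [zonal, ← mul_one (linForm x), fischer_linForm_mul,
      hone x _ (isHomogeneous_dirDeriv x hg), eval_dirDeriv_self x hg]
    simp
  | more ℓ _ h1 =>
    obtain ⟨c, hc, h1⟩ := h1
    have hℓ : (0 : ℝ) ≤ ℓ := Nat.cast_nonneg _
    have hd : (0 : ℝ) < (ℓ : ℝ) + n - 1 := by linarith
    -- By adjointness the `|Y|²` term pairs with `Δg = 0`. The other term pairs the harmonic form
    -- `dirDeriv x g` with `zonal x (ℓ + 1)`, giving `c` times its value `(ℓ + 2) g(x)` at `x`.
    refine ⟨(2 * ℓ + n : ℝ) / (ℓ + n - 1) * (c * (ℓ + 2)), by positivity, fun x g hg h => ?_⟩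
    have hz : ∀ p, fischer (0 : MvPolynomial (Fin n) ℝ) p = 0 := fun p => by
      simpa using fischer_smul_left 0 0 p
    rw [zonal, map_sub, fischer_C_mul, fischer_C_mul, fischer_linForm_mul, fischer_normSqForm_mul,
      h, hz, h1 x _ (isHomogeneous_dirDeriv x hg) (by rw [laplace_dirDeriv, h, map_zero]),
      eval_dirDeriv_self x hg]
    push_cast
    ring

/-- The kernels `P_ℓ(x · y)` on the sphere are positive semidefinite. -/
lemma gegenbauer_posSemidef (hn : 2 ≤ n) (ℓ : ℕ) {ι : Type*} [Fintype ι]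
    (x : ι → Fin n → ℝ) (hx : ∀ i, ∑ k, x i k ^ 2 = 1) (w : ι → ℝ) :
    0 ≤ ∑ i, ∑ j, w i * w j * (gegenbauer n ℓ).eval (∑ k, x i k * x j k) := by
  obtain ⟨c, hc, h⟩ := exists_fischer_zonal hn ℓ
  -- The reproducing property with `g = zonal (x i) ℓ` identifies the double sum with a Fischer
  -- square norm.
  have key : fischer (∑ i, w i • zonal (x i) ℓ) (∑ i, w i • zonal (x i) ℓ) =
      c * ∑ i, ∑ j, w i * w j * (gegenbauer n ℓ).eval (∑ k, x i k * x j k) := by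
    rw [fischer_sum_left, Finset.mul_sum]
    refine Finset.sum_congr rfl fun i _ => ?_
    rw [map_sum, Finset.mul_sum]
    refine Finset.sum_congr rfl fun j _ => ?_
    rw [fischer_smul_left, map_smul, h _ _ (isHomogeneous_zonal _ _) (laplace_zonal hn _ _),
      eval_zonal (hx i) (hx j), smul_eq_mul]
    ring
  have := fischer_self_nonneg (∑ i, w i • zonal (x i) ℓ)
  rw [key] at this
  exact nonneg_of_mul_nonneg_right this hc

end Fischer

/-! ### Mean values of harmonic polynomials, through Gaussian integrals. -/

section Gaussian

variable {n : ℕ}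

lemma continuous_eval_euclidean (p : MvPolynomial (Fin n) ℝ) :
    Continuous fun y : EuclideanSpace ℝ (Fin n) => eval (fun k => y k) p := by
  have h : Continuous fun y : EuclideanSpace ℝ (Fin n) => fun k => y k := by fun_prop
  exact (MvPolynomial.continuous_eval p).comp h

lemma integrable_norm_pow_mul_gaussian (hn : 1 ≤ n) (d : ℕ) :
    Integrable fun y : EuclideanSpace ℝ (Fin n) => ‖y‖ ^ d * Real.exp (-(1 / 2) * ‖y‖ ^ 2) := by
  have : Nonempty (Fin n) := ⟨⟨0, hn⟩⟩
  refine (integrable_fun_norm_addHaar (volume : Measure (EuclideanSpace ℝ (Fin n)))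
    (f := fun r : ℝ => r ^ d * Real.exp (-(1 / 2) * r ^ 2))).2 ?_
  have h := integrable_rpow_mul_exp_neg_mul_sq (b := 1 / 2) (by norm_num)
    (s := ((Module.finrank ℝ (EuclideanSpace ℝ (Fin n)) - 1 + d : ℕ) : ℝ))
    (lt_of_lt_of_le (by norm_num) (Nat.cast_nonneg _))
  refine h.integrableOn.congr_fun (fun r _ => ?_) measurableSet_Ioi
  simp only [Real.rpow_natCast, pow_add, smul_eq_mul]
  ring

lemma integrable_eval_mul_gaussian (hn : 1 ≤ n) (p : MvPolynomial (Fin n) ℝ) :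
    Integrable fun y : EuclideanSpace ℝ (Fin n) =>
      eval (fun k => y k) p * Real.exp (-(1 / 2) * ‖y‖ ^ 2) := by
  induction p using MvPolynomial.induction_on' with
  | monomial α a =>
    refine ((integrable_norm_pow_mul_gaussian hn (∑ i, α i)).const_mul |a|).mono'
      (((continuous_eval_euclidean _).mul (by fun_prop)).aestronglyMeasurable)
      (Filter.Eventually.of_forall fun y => ?_)
    rw [eval_monomial, Finsupp.prod_fintype _ _ (fun _ => pow_zero _), norm_mul, norm_mul,
      Real.norm_eq_abs a, Real.norm_of_nonneg (Real.exp_pos _).le, mul_assoc]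
    -- Each coordinate is at most `‖y‖` in absolute value, so the monomial is dominated by a power
    -- of the norm.
    gcongr
    rw [norm_prod, ← Finset.prod_pow_eq_pow_sum]
    refine Finset.prod_le_prod (fun _ _ => norm_nonneg _) fun i _ => ?_
    rw [norm_pow]
    exact pow_le_pow_left₀ (norm_nonneg _) (PiLp.norm_apply_le y i) _
  | add p q hp hq =>
    refine (hp.add hq).congr (Filter.Eventually.of_forall fun y => ?_)
    simp [add_mul]

lemma hasLineDerivAt_eval (p : MvPolynomial (Fin n) ℝ) (y : EuclideanSpace ℝ (Fin n))
    (i : Fin n) :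
    HasLineDerivAt ℝ (fun y : EuclideanSpace ℝ (Fin n) => eval (fun k => y k) p)
      (eval (fun k => y k) (pderiv i p)) y (EuclideanSpace.single i 1) := by
  have hX : ∀ j, HasDerivAt (fun t : ℝ => (y + t • EuclideanSpace.single i (1 : ℝ)) j)
      (eval (fun k => y k) (pderiv i (X j))) 0 := by
    intro j
    have h : HasDerivAt (fun t : ℝ => y j + t * (EuclideanSpace.single i (1 : ℝ)) j)
      (1 * (EuclideanSpace.single i (1 : ℝ)) j) 0 :=
      ((hasDerivAt_id (0 : ℝ)).mul_const _).const_add _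
    refine h.congr_deriv ?_
    rw [pderiv_X]
    rcases eq_or_ne j i with rfl | hij
    · simp
    · simp [hij]
  unfold HasLineDerivAt
  induction p using MvPolynomial.induction_on with
  | C a => simpa using hasDerivAt_const (0 : ℝ) a
  | add p q hp hq => 
    simp only [map_add]
    exact hp.add hq
  | mul_X p j hp =>
    simp only [map_mul, eval_X, pderiv_mul, map_add]
    refine (hp.mul (hX j)).congr_deriv ?_
    simp

lemma hasLineDerivAt_gaussian (y : EuclideanSpace ℝ (Fin n)) (i : Fin n) :
    HasLineDerivAt ℝ (fun y : EuclideanSpace ℝ (Fin n) => Real.exp (-(1 / 2) * ‖y‖ ^ 2))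
      (-(y i * Real.exp (-(1 / 2) * ‖y‖ ^ 2))) y (EuclideanSpace.single i 1) := by
  unfold HasLineDerivAt
  have e : ∀ t : ℝ, ‖y + t • EuclideanSpace.single i (1 : ℝ)‖ ^ 2 =
      ‖y‖ ^ 2 + 2 * (t * y i) + t ^ 2 := by
    intro t
    rw [norm_add_sq_real, inner_smul_right, EuclideanSpace.inner_single_right, norm_smul]
    simp
  simp only [e]
  have h : HasDerivAt (fun t : ℝ => ‖y‖ ^ 2 + 2 * (t * y i) + t ^ 2) (2 * y i) 0 := by
    have h1 := (((hasDerivAt_id (0 : ℝ)).mul_const (y i)).const_mul 2).const_add (‖y‖ ^ 2)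
    have h2 := h1.add ((hasDerivAt_id (0 : ℝ)).pow 2)
    exact h2.congr_deriv (by simp)
  refine ((h.const_mul (-(1 / 2))).exp).congr_deriv ?_
  simp
  ring

/-- Gaussian integration by parts. -/
lemma integral_X_mul_gaussian (hn : 1 ≤ n) (p : MvPolynomial (Fin n) ℝ) (i : Fin n) :
    ∫ y : EuclideanSpace ℝ (Fin n), eval (fun k => y k) (X i * p) *
        Real.exp (-(1 / 2) * ‖y‖ ^ 2) =
      ∫ y : EuclideanSpace ℝ (Fin n), eval (fun k => y k) (pderiv i p) *
        Real.exp (-(1 / 2) * ‖y‖ ^ 2) := by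
  have hX := integrable_eval_mul_gaussian hn (X i * p)
  have h := integral_bilinear_hasLineDerivAt_right_eq_neg_left_of_integrable
    (μ := (volume : Measure (EuclideanSpace ℝ (Fin n)))) (B := ContinuousLinearMap.mul ℝ ℝ)
    (f := fun y : EuclideanSpace ℝ (Fin n) => eval (fun k => y k) p)
    (g := fun y => Real.exp (-(1 / 2) * ‖y‖ ^ 2))
    (integrable_eval_mul_gaussian hn (pderiv i p)) ?_ (integrable_eval_mul_gaussian hn p)
    (fun y _ => hasLineDerivAt_eval p y i) (fun y _ => hasLineDerivAt_gaussian y i)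
  · simp only [ContinuousLinearMap.mul_apply'] at h
    rw [← neg_inj, ← h, ← integral_neg]
    congr 1 with y
    simp
    ring
  · refine hX.neg.congr (Filter.Eventually.of_forall fun y => ?_)
    simp
    ring

/-- With Gaussian integrals throughout, Euler's identity and integration by parts give `d ∫ p = ∑ ∫
X_i ∂_i p = ∫ Δp = 0`, and `d ≠ 0`. -/
lemma integral_harmonic_gaussian (hn : 1 ≤ n) {d : ℕ} (hd : 1 ≤ d) {p : MvPolynomial (Fin n) ℝ}
    (hp : p.IsHomogeneous d) (hl : laplace p = 0) :
    ∫ y : EuclideanSpace ℝ (Fin n), eval (fun k => y k) p * Real.exp (-(1 / 2) * ‖y‖ ^ 2) = 0 := by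
  have hsum : ∀ q : Fin n → MvPolynomial (Fin n) ℝ,
      ∫ y : EuclideanSpace ℝ (Fin n), eval (fun k => y k) (∑ i, q i) *
        Real.exp (-(1 / 2) * ‖y‖ ^ 2) =
      ∑ i, ∫ y : EuclideanSpace ℝ (Fin n), eval (fun k => y k) (q i) *
        Real.exp (-(1 / 2) * ‖y‖ ^ 2) := fun q => by
    rw [← integral_finsetSum _ fun i _ => integrable_eval_mul_gaussian hn (q i)]
    simp only [map_sum, Finset.sum_mul]
  have h1 := hsum fun i => X i * pderiv i p
  have h2 := hsum fun i => pderiv i (pderiv i p)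
  simp only [integral_X_mul_gaussian hn] at h1
  rw [← h2, ← laplace, hl, hp.sum_X_mul_pderiv] at h1
  simp only [nsmul_eq_mul, map_mul, map_natCast, mul_assoc, map_zero, zero_mul, integral_zero,
    integral_const_mul] at h1
  exact (mul_eq_zero.1 h1).resolve_left (by positivity)

lemma eval_smul_of_isHomogeneous {d : ℕ} {p : MvPolynomial (Fin n) ℝ} (hp : p.IsHomogeneous d)
    (r : ℝ) (y : Fin n → ℝ) : eval (fun k => r * y k) p = r ^ d * eval y p := by
  rw [eval_eq', eval_eq', Finset.mul_sum]
  refine Finset.sum_congr rfl fun α hα => ?_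
  have h : ∑ i, α i = d := by
    rw [← hp (mem_support_iff.1 hα), Finsupp.weight_apply, Finsupp.sum_fintype] <;> simp
  simp only [mul_pow, Finset.prod_mul_distrib, Finset.prod_pow_eq_pow_sum, h]
  ring

/-- Integration in polar coordinates of a separated function. -/
lemma integral_polar (hn : 1 ≤ n) (F : EuclideanSpace ℝ (Fin n) → ℝ)
    (f : Metric.sphere (0 : EuclideanSpace ℝ (Fin n)) 1 → ℝ) (g : ℝ → ℝ)
    (h : ∀ (ω : Metric.sphere (0 : EuclideanSpace ℝ (Fin n)) 1) (r : ℝ), 0 < r →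
      F (r • (ω : EuclideanSpace ℝ (Fin n))) = f ω * g r) :
    ∫ y, F y = (∫ ω, f ω ∂(volume : Measure (EuclideanSpace ℝ (Fin n))).toSphere) *
      ∫ r : Set.Ioi (0 : ℝ), g r ∂(Measure.volumeIoiPow (n - 1)) := by
  have : Nonempty (Fin n) := ⟨⟨0, hn⟩⟩
  have hdim : Module.finrank ℝ (EuclideanSpace ℝ (Fin n)) = n := by simp
  -- The origin is a null set, and its complement is the product of the sphere and the half-line.
  calc ∫ y, F y = ∫ x : ({(0)}ᶜ : Set (EuclideanSpace ℝ (Fin n))), F x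
        ∂((volume : Measure (EuclideanSpace ℝ (Fin n))).comap (↑)) := by
        rw [integral_subtype_comap (measurableSet_singleton _).compl F,
          restrict_compl_singleton]
    _ = ∫ x, f x.1 * g x.2 ∂((volume : Measure (EuclideanSpace ℝ (Fin n))).toSphere.prod
          (Measure.volumeIoiPow (Module.finrank ℝ (EuclideanSpace ℝ (Fin n)) - 1))) := by
        rw [← ((volume : Measure (EuclideanSpace ℝ
          (Fin n))).measurePreserving_homeomorphUnitSphereProd).integral_comp
          (Homeomorph.measurableEmbedding _)]
        congr 1 with x
        have hx : ‖(x : EuclideanSpace ℝ (Fin n))‖ ≠ 0 := norm_ne_zero_iff.2 x.2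
        rw [← h _ _ (by simpa using norm_ne_zero_iff.1 hx)]
        congr 1
        rw [homeomorphUnitSphereProd_apply_fst_coe, homeomorphUnitSphereProd_apply_snd_coe,
          smul_smul, mul_inv_cancel₀ hx, one_smul]
    _ = _ := by
        rw [hdim]
        exact integral_prod_mul (L := ℝ) f fun r : Set.Ioi (0 : ℝ) => g r

/-- In polar coordinates the vanishing Gaussian integral is the spherical integral times a nonzero
radial one. -/
lemma integral_sphere_harmonic (hn : 1 ≤ n) {d : ℕ} (hd : 1 ≤ d) {p : MvPolynomial (Fin n) ℝ}
    (hp : p.IsHomogeneous d) (hl : laplace p = 0) :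
    ∫ y : Metric.sphere (0 : EuclideanSpace ℝ (Fin n)) 1,
      eval (fun k => (y : EuclideanSpace ℝ (Fin n)) k) p ∂(sphereProb n) = 0 := by
  have : Nonempty (Fin n) := ⟨⟨0, hn⟩⟩
  have h1 := integral_polar hn
    (fun y => eval (fun k => y k) p * Real.exp (-(1 / 2) * ‖y‖ ^ 2))
    (fun ω => eval (fun k => (ω : EuclideanSpace ℝ (Fin n)) k) p)
    (fun r => r ^ d * Real.exp (-(1 / 2) * r ^ 2)) (fun ω r hr => by
      simp only [PiLp.smul_apply, smul_eq_mul, eval_smul_of_isHomogeneous hp, norm_smul,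
        norm_eq_of_mem_sphere, Real.norm_of_nonneg hr.le]
      ring_nf)
  -- The same radial factor occurs in the positive integral of `‖y‖^d` against the Gaussian, so it
  -- is nonzero and need not be computed.
  have h2 := integral_polar hn
    (fun y => ‖y‖ ^ d * Real.exp (-(1 / 2) * ‖y‖ ^ 2)) (fun _ => 1)
    (fun r => r ^ d * Real.exp (-(1 / 2) * r ^ 2)) (fun ω r hr => by
      simp only [norm_smul, norm_eq_of_mem_sphere, Real.norm_of_nonneg hr.le]
      ring_nf)
  rw [integral_harmonic_gaussian hn hd hp hl] at h1
  have hpos : 0 < ∫ y : EuclideanSpace ℝ (Fin n), ‖y‖ ^ d * Real.exp (-(1 / 2) * ‖y‖ ^ 2) := by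
    refine integral_pos_of_integrable_nonneg_nonzero (x := EuclideanSpace.single ⟨0, hn⟩ 1)
      (by fun_prop) (integrable_norm_pow_mul_gaussian hn d) (fun y => by positivity) ?_
    simp
  rw [h2] at hpos
  rw [sphereProb, integral_smul_measure,
    (mul_eq_zero.1 h1.symm).resolve_right (right_ne_zero_of_mul hpos.ne'), smul_zero]

end Gaussian

/-! ### From vanishing moments to exact cubature. -/

section Cubature

variable {n N : ℕ}

lemma sum_sq_eq_one {x : EuclideanSpace ℝ (Fin n)} (hx : ‖x‖ = 1) : ∑ k, x k ^ 2 = 1 := by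
  rw [← EuclideanSpace.real_norm_sq_eq, hx, one_pow]

lemma inner_eq_sum (x y : EuclideanSpace ℝ (Fin n)) : inner ℝ x y = ∑ k, x k * y k := by
  simp [PiLp.inner_apply, mul_comm]

/-- A vanishing moment of order `ℓ` forces the weighted zonal sum of order `ℓ` to vanish. -/
lemma WeightedCode.sum_gegenbauer_eq_zero (hn : 2 ≤ n) (C : WeightedCode n N) {ℓ : ℕ}
    (h : C.moment ℓ = 0) {y : EuclideanSpace ℝ (Fin n)} (hy : ‖y‖ = 1) :
    ∑ i, C.weight i * (gegenbauer n ℓ).eval (inner ℝ (C.pt i) y) = 0 := by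
  set S := ∑ i, C.weight i * (gegenbauer n ℓ).eval (inner ℝ (C.pt i) y) with hS
  -- Adjoin `y` to the code with mass `ε` of either sign: the quadratic form becomes `M_ℓ + 2εS + ε²
  -- P_ℓ(1)`, where `M_ℓ = 0` and `P_ℓ(1) = 1`.
  have key : ∀ ε : ℝ, 0 ≤ 2 * ε * S + ε ^ 2 := by
    intro ε
    have hp := gegenbauer_posSemidef hn ℓ (ι := Option (Fin N))
      (fun o k => (o.elim y C.pt) k)
      (fun o => sum_sq_eq_one (by cases o <;> simp [hy, C.norm_pt]))
      (fun o => o.elim ε C.weight)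
    simp only [← inner_eq_sum, Fintype.sum_option, Option.elim, real_inner_self_eq_norm_sq, hy,
      one_pow, gegenbauer_eval_one hn, Finset.sum_add_distrib] at hp
    have e1 : ∑ i, ε * C.weight i * (gegenbauer n ℓ).eval (inner ℝ y (C.pt i)) = ε * S := by
      rw [hS, Finset.mul_sum]
      exact Finset.sum_congr rfl fun i _ => by rw [real_inner_comm]; ring
    have e2 : ∑ i, C.weight i * ε * (gegenbauer n ℓ).eval (inner ℝ (C.pt i) y) = ε * S := by
      rw [hS, Finset.mul_sum]
      exact Finset.sum_congr rfl fun i _ => by ring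
    rw [WeightedCode.moment] at h
    rw [e1, e2, h] at hp
    linarith
  -- The choice `ε = -S` gives `-S² ≥ 0`.
  have := key (-S)
  nlinarith [sq_nonneg S]

lemma isProbabilityMeasure_sphereProb (hn : 1 ≤ n) : IsProbabilityMeasure (sphereProb n) :=
  ⟨sphereProb_univ hn⟩

lemma integrable_sphere (hn : 1 ≤ n) {f : EuclideanSpace ℝ (Fin n) → ℝ} (hf : Continuous f) :
    Integrable (fun y : Metric.sphere (0 : EuclideanSpace ℝ (Fin n)) 1 => f y) (sphereProb n) := by
  have := isProbabilityMeasure_sphereProb hn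
  exact (hf.comp continuous_subtype_val).integrable_of_hasCompactSupport
    (HasCompactSupport.of_compactSpace _)

lemma integral_gegenbauer (hn : 2 ≤ n) {ℓ : ℕ} (hℓ : 1 ≤ ℓ) {x : EuclideanSpace ℝ (Fin n)}
    (hx : ‖x‖ = 1) :
    ∫ y : Metric.sphere (0 : EuclideanSpace ℝ (Fin n)) 1,
      (gegenbauer n ℓ).eval (inner ℝ x (y : EuclideanSpace ℝ (Fin n))) ∂(sphereProb n) = 0 := by
  rw [← integral_sphere_harmonic (by omega) hℓ (isHomogeneous_zonal x ℓ) (laplace_zonal hn x ℓ)]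
  congr 1 with y
  rw [eval_zonal (sum_sq_eq_one hx) (sum_sq_eq_one (norm_eq_of_mem_sphere y)), inner_eq_sum]

/-- The error of the cubature formula with the nodes and weights of a weighted code. -/
def WeightedCode.error (hn : 1 ≤ n) (C : WeightedCode n N) : MvPolynomial (Fin n) ℝ →ₗ[ℝ] ℝ where
  toFun p := ∫ y : Metric.sphere (0 : EuclideanSpace ℝ (Fin n)) 1,
      eval (fun k => (y : EuclideanSpace ℝ (Fin n)) k) p ∂(sphereProb n) -
    ∑ i, C.weight i * eval (fun k => C.pt i k) p
  map_add' p q := by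
    simp only [map_add, mul_add, Finset.sum_add_distrib]
    rw [integral_add (integrable_sphere hn (continuous_eval_euclidean p))
      (integrable_sphere hn (continuous_eval_euclidean q))]
    ring
  map_smul' c p := by
    simp only [smul_eval, integral_const_mul, RingHom.id_apply, smul_eq_mul, mul_sub,
      Finset.mul_sum]
    congr 1
    exact Finset.sum_congr rfl fun i _ => by ring

/-- The univariate polynomials of degree at most `τ` lie in any submodule containing the
Gegenbauer polynomials of degree at most `τ`. -/
lemma mem_of_gegenbauer_mem (hn : 2 ≤ n) (τ : ℕ) (V : Submodule ℝ (Polynomial ℝ))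
    (hV : ∀ ℓ ≤ τ, gegenbauer n ℓ ∈ V) (q : Polynomial ℝ) (hq : q.natDegree ≤ τ) : q ∈ V := by
  induction τ generalizing q with
  | zero =>
    rw [Polynomial.eq_C_of_natDegree_le_zero hq, ← mul_one (Polynomial.C _),
      ← Polynomial.smul_eq_C_mul]
    exact V.smul_mem _ (hV 0 le_rfl)
  | succ τ ih =>
    obtain ⟨h1, h2⟩ := gegenbauer_natDegree_leadingCoeff hn (τ + 1)
    -- Subtracting `c` times the Gegenbauer polynomial cancels the coefficient of degree `τ + 1`.
    set c := q.coeff (τ + 1) / (gegenbauer n (τ + 1)).coeff (τ + 1) with hc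
    have hr : (q - c • gegenbauer n (τ + 1)).natDegree ≤ τ := by
      refine Polynomial.natDegree_le_iff_coeff_eq_zero.2 fun m hm => ?_
      rw [Polynomial.coeff_sub, Polynomial.coeff_smul, smul_eq_mul]
      rcases (Nat.succ_le_of_lt hm).eq_or_lt with rfl | hm'
      · rw [hc, div_mul_cancel₀ _ h2, sub_self]
      · rw [Polynomial.coeff_eq_zero_of_natDegree_lt (lt_of_le_of_lt hq hm'),
          Polynomial.coeff_eq_zero_of_natDegree_lt (lt_of_le_of_lt h1 hm'), mul_zero, sub_zero]
    have := V.add_mem (ih (fun ℓ hℓ => hV ℓ (by omega)) _ hr)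
      (V.smul_mem c (hV (τ + 1) le_rfl))
    rwa [sub_add_cancel] at this

/-- Polarization: a linear functional vanishing on the `d`-th powers of linear forms vanishes on
all monomials of degree `d`. -/
lemma eq_zero_of_linForm_pow (L : MvPolynomial (Fin n) ℝ →ₗ[ℝ] ℝ) (d : ℕ)
    (hL : ∀ x : Fin n → ℝ, L (linForm x ^ d) = 0) (α : Fin n →₀ ℕ) (hα : ∑ i, α i = d) :
    L (monomial α 1) = 0 := by
  classical
  set s := Finset.piAntidiag (Finset.univ : Finset (Fin n)) d
  -- `Q` is `x ↦ L((x · Y)^d)` as a polynomial in `x`, by the multinomial theorem. It vanishes at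
  -- every real point, hence identically, and its coefficients are nonzero multiples of the values
  -- of `L` on monomials.
  set Q : MvPolynomial (Fin n) ℝ := ∑ k ∈ s, monomial (Finsupp.equivFunOnFinite.symm k)
    ((Nat.multinomial Finset.univ k : ℝ) * L (monomial (Finsupp.equivFunOnFinite.symm k) 1))
    with hQdef
  have hQ : Q = 0 := by
    refine MvPolynomial.funext fun x => ?_
    rw [map_zero, ← hL x, linForm, Finset.sum_pow_eq_sum_piAntidiag, map_sum, map_sum]
    refine Finset.sum_congr rfl fun k _ => ?_
    have h : (Nat.multinomial Finset.univ k : MvPolynomial (Fin n) ℝ) *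
        ∏ i, (C (x i) * X i) ^ k i =
        ((Nat.multinomial Finset.univ k : ℝ) * ∏ i, x i ^ k i) •
          monomial (Finsupp.equivFunOnFinite.symm k) 1 := by
      rw [monomial_eq, Finsupp.prod_fintype _ _ (fun _ => pow_zero _), smul_eq_C_mul]
      simp only [mul_pow, Finset.prod_mul_distrib, C_mul, map_prod, map_pow, map_natCast, map_one,
        one_mul, Finsupp.equivFunOnFinite_symm_apply_apply]
      ring
    rw [h, map_smul, eval_monomial, Finsupp.prod_fintype _ _ (fun _ => pow_zero _), smul_eq_mul]
    simp only [Finsupp.equivFunOnFinite_symm_apply_apply]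
    ring
  have hc := congrArg (coeff α) hQ
  rw [hQdef, coeff_sum, coeff_zero, Finset.sum_eq_single (α : Fin n → ℕ)] at hc
  · have he : Finsupp.equivFunOnFinite.symm (α : Fin n → ℕ) = α :=
      Finsupp.equivFunOnFinite.symm_apply_apply α
    rw [he, coeff_monomial, if_pos rfl] at hc
    refine (mul_eq_zero.1 hc).resolve_left ?_
    exact_mod_cast (Nat.multinomial_pos _ _).ne'
  · intro k _ hk
    rw [coeff_monomial, if_neg]
    rintro rfl
    exact hk (by ext; simp)
  · intro h
    exact absurd (Finset.mem_piAntidiag.2 ⟨hα, fun i _ => Finset.mem_univ i⟩) h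

lemma WeightedCode.error_linForm_pow_of_norm (hn : 2 ≤ n) {τ : ℕ} {C : WeightedCode n N}
    (hC : C.IsDesign τ) {d : ℕ} (hd : d ≤ τ) {x : EuclideanSpace ℝ (Fin n)} (hx : ‖x‖ = 1) :
    C.error (by omega) (linForm x ^ d) = 0 := by
  have := isProbabilityMeasure_sphereProb (n := n) (by omega)
  have hint : ∀ q : Polynomial ℝ, Integrable
      (fun y : Metric.sphere (0 : EuclideanSpace ℝ (Fin n)) 1 =>
        q.eval (inner ℝ x (y : EuclideanSpace ℝ (Fin n)))) (sphereProb n) := fun q =>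
    integrable_sphere (by omega) (f := fun y => q.eval (inner ℝ x y))
      (q.continuous.comp (by fun_prop))
  -- The univariate `q` for which the formula is exact on `y ↦ q(x · y)`.
  let V : Submodule ℝ (Polynomial ℝ) :=
    { carrier := {q | ∫ y : Metric.sphere (0 : EuclideanSpace ℝ (Fin n)) 1,
        q.eval (inner ℝ x (y : EuclideanSpace ℝ (Fin n))) ∂(sphereProb n) =
          ∑ i, C.weight i * q.eval (inner ℝ x (C.pt i))}
      zero_mem' := by simp
      add_mem' := fun {p q} hp hq => by
        simp only [Set.mem_ofPred_eq, Polynomial.eval_add, mul_add, Finset.sum_add_distrib] at *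
        rw [integral_add (hint p) (hint q), hp, hq]
      smul_mem' := fun c q hq => by
        simp only [Set.mem_ofPred_eq, Polynomial.eval_smul, smul_eq_mul, integral_const_mul] at *
        rw [hq, Finset.mul_sum]
        exact Finset.sum_congr rfl fun i _ => by ring }
  have hV : Polynomial.X ^ d ∈ V := by
    refine mem_of_gegenbauer_mem hn τ V (fun ℓ hℓ => ?_) _ (by simpa using hd)
    change _ = _
    rcases Nat.eq_zero_or_pos ℓ with rfl | hpos
    -- For `ℓ = 0` both sides are total masses, equal to 1.
    · simp [gegenbauer, C.weight_sum]
    · rw [integral_gegenbauer hn hpos hx, ← C.sum_gegenbauer_eq_zero hn (hC ℓ hpos hℓ) hx]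
      simp only [real_inner_comm x]
  change _ = _ at hV
  simp only [Polynomial.eval_pow, Polynomial.eval_X, inner_eq_sum] at hV
  refine sub_eq_zero.2 ?_
  simpa only [map_pow, eval_linForm] using hV

lemma WeightedCode.error_linForm_pow (hn : 2 ≤ n) {τ : ℕ} {C : WeightedCode n N}
    (hC : C.IsDesign τ) {d : ℕ} (hd : d ≤ τ) (x : Fin n → ℝ) :
    C.error (by omega) (linForm x ^ d) = 0 := by
  obtain ⟨r, u, hu, rfl⟩ : ∃ (r : ℝ) (u : EuclideanSpace ℝ (Fin n)), ‖u‖ = 1 ∧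
      x = fun k => r * u k := by
    rcases eq_or_ne x 0 with rfl | hx
    -- For `x = 0` any unit vector serves; when `d = 0`, the convention `0 ^ 0 = 1` keeps the
    -- scaling identity valid.
    · refine ⟨0, EuclideanSpace.single ⟨0, by omega⟩ 1, by simp, ?_⟩
      ext k
      simp
    · have hx' : ‖(WithLp.toLp 2 x : EuclideanSpace ℝ (Fin n))‖ ≠ 0 := by
        simpa using hx
      refine ⟨‖(WithLp.toLp 2 x : EuclideanSpace ℝ (Fin n))‖,
        ‖(WithLp.toLp 2 x : EuclideanSpace ℝ (Fin n))‖⁻¹ • WithLp.toLp 2 x, ?_, ?_⟩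
      · rw [norm_smul, norm_inv, norm_norm, inv_mul_cancel₀ hx']
      · ext k
        simp only [PiLp.smul_apply, smul_eq_mul, mul_inv_cancel_left₀ hx']
  have h : linForm (fun k => r * u k) ^ d = r ^ d • linForm u ^ d := by
    rw [← smul_pow]
    simp only [linForm, Finset.smul_sum, C_mul, smul_eq_C_mul, mul_assoc]
  rw [h, map_smul, C.error_linForm_pow_of_norm hn hC hd hu, smul_zero]

end Cubature

end SphericalDesign

end

/-- A weighted spherical code on the unit sphere of `ℝⁿ`, `n ≥ 2`, is a weighted spherical
`τ`-design if and only if the cubature formula with its nodes and weights is exact for all real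
polynomials in `n` variables of total degree at most `τ`. -/
theorem lemma5p2 (n N τ : ℕ) (hn : 2 ≤ n) (C : SphericalDesign.WeightedCode n N) :
    C.IsDesign τ ↔
      ∀ p : MvPolynomial (Fin n) ℝ, p.totalDegree ≤ τ →
        ∫ y : Metric.sphere (0 : EuclideanSpace ℝ (Fin n)) 1,
            MvPolynomial.eval (fun k => (y : EuclideanSpace ℝ (Fin n)) k) p
              ∂(SphericalDesign.sphereProb n) =
          ∑ i, C.weight i * MvPolynomial.eval (fun k => C.pt i k) p := by
  constructor
  · intro hC p hp
    suffices h : C.error (by omega) p = 0 from sub_eq_zero.1 h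
    rw [p.as_sum, map_sum]
    refine Finset.sum_eq_zero fun α hα => ?_
    have hd : ∑ i, α i ≤ τ := by
      refine le_trans ?_ ((MvPolynomial.le_totalDegree hα).trans hp)
      rw [Finsupp.sum_fintype _ _ (fun _ => rfl)]
    have h := SphericalDesign.eq_zero_of_linForm_pow (C.error (by omega)) _
      (fun x => C.error_linForm_pow hn hC hd x) α rfl
    rw [← mul_one (MvPolynomial.coeff α p), ← smul_eq_mul, ← MvPolynomial.smul_monomial, map_smul,
      h, smul_zero]
  · intro h ℓ hℓ hτ
    rw [SphericalDesign.WeightedCode.moment]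
    -- Exactness makes each row of the double sum vanish separately.
    refine Finset.sum_eq_zero fun i _ => ?_
    have hz := h (SphericalDesign.zonal (C.pt i) ℓ)
      ((SphericalDesign.isHomogeneous_zonal (C.pt i) ℓ).totalDegree_le.trans hτ)
    rw [SphericalDesign.integral_sphere_harmonic (by omega) hℓ
      (SphericalDesign.isHomogeneous_zonal _ ℓ) (SphericalDesign.laplace_zonal hn _ ℓ)] at hz
    simp only [mul_assoc]
    rw [← Finset.mul_sum]
    refine mul_eq_zero_of_right _ ?_
    rw [hz]
    refine Finset.sum_congr rfl fun j _ => ?_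
    rw [SphericalDesign.eval_zonal (SphericalDesign.sum_sq_eq_one (C.norm_pt i))
      (SphericalDesign.sum_sq_eq_one (C.norm_pt j)), SphericalDesign.inner_eq_sum]
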